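/- Let $q$ be a nonnegative integer, and let $A=(a_1,\dots,a_q)$ and $B=(b_1,\dots,b_q)$ be real tuples such that $B$ is weakly supermajorized by $A$, that is, $$0<a_1\le a_2\le\cdots\le a_q,\qquad 0<b_1\le b_2\le\cdots\le b_q,\qquad \sum_{i=1}^k a_i\le\sum_{i=1}^k b_i\quad(k=1,\dots,q).$$ Let $\delta>0$ and $\sigma\in\mathbb R$, and write $A+\delta=(a_1+\delta,\dots,a_q+\delta)$, $B+\delta=(b_1+\delta,\dots,b_q+\delta)$. Let ${}_{q+1}F_q(\sigma,A;B;z)$ denote the analytic continuation to $\mathbb C\setminus[1,\infty)$ of the sum of the series $$\sum_{n=0}^\infty\frac{(\sigma)_n(a_1)_n\cdots(a_q)_n}{(b_1)_n\cdots(b_q)_n\,n!}z^n\quad(|z|<1),\qquad (a)_0=1,\quad (a)_n=a(a+1)\cdots(a+n-1),$$ and similarly for ${}_{q+1}F_q(\sigma,A+\delta;B+\delta;z)$. Then both continuations exist, both functions are real at $z=-x$ for every real $x>-1$, ${}_{q+1}F_q(\sigma,A;B;-x)\neq0$ for these $x$, and the function $$x\mapsto\frac{{}_{q+1}F_q(\sigma,A+\delta;B+\delta;-x)}{{}_{q+1}F_q(\sigma,A;B;-x)}$$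 is (weakly) decreasing on $(-1,\infty)$ if $\sigma>0$ and (weakly) increasing on $(-1,\infty)$ if $\sigma<0$. -/

import Mathlib

/-- The `n`-th Taylor coefficient
`(σ)ₙ (a₁)ₙ ⋯ (a_q)ₙ / ((b₁)ₙ ⋯ (b_q)ₙ n!)` of the generalized hypergeometric series
`_{q+1}F_q(σ, A; B; z)`. -/
noncomputable def hyperCoeff {q : ℕ} (σ : ℂ) (A B : Fin q → ℂ) (n : ℕ) : ℂ :=
  (ascPochhammer ℂ n).eval σ * (∏ i, (ascPochhammer ℂ n).eval (A i)) /
    ((∏ i, (ascPochhammer ℂ n).eval (B i)) * (n.factorial : ℂ))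

/-- The complex plane cut along the ray `[1, ∞)`. -/
def cutPlane : Set ℂ := {z : ℂ | ¬ (1 ≤ z.re ∧ z.im = 0)}

/-- `f` is holomorphic in the plane cut along `[1, ∞)` and is, in the open unit disk, the sum of
the hypergeometric series. -/
structure IsHyperContinuation {q : ℕ} (σ : ℂ) (A B : Fin q → ℂ) (f : ℂ → ℂ) : Prop where
  differentiableOn : DifferentiableOn ℂ f cutPlane
  hasSum : ∀ z : ℂ, ‖z‖ < 1 → HasSum (fun n : ℕ => hyperCoeff σ A B n * z ^ n) (f z)

open Classical in
/-- The generalized hypergeometric function `_{q+1}F_q(σ, A; B; z)`: the analytic continuation of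
the hypergeometric series to the plane cut along `[1, ∞)`. Its values on the cut carry no
meaning. -/
noncomputable def hyperF {q : ℕ} (σ : ℂ) (A B : Fin q → ℂ) (z : ℂ) : ℂ :=
  if h : ∃ f : ℂ → ℂ, IsHyperContinuation σ A B f then h.choose z
  else ∑' n : ℕ, hyperCoeff σ A B n * z ^ n

theorem cutPlane_eq : cutPlane = {z : ℂ | 1 - z ∈ Complex.slitPlane} := by
  ext z
  simp only [cutPlane, Set.mem_ofPred_eq, Complex.mem_slitPlane_iff, Complex.sub_re,
    Complex.one_re, Complex.sub_im, Complex.one_im, zero_sub, ne_eq, neg_eq_zero, not_and_or,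
    not_le, sub_pos]

theorem isOpen_cutPlane : IsOpen cutPlane := by
  rw [cutPlane_eq]
  exact Complex.isOpen_slitPlane.preimage (continuous_const.sub continuous_id)

theorem isPreconnected_cutPlane : IsPreconnected cutPlane := by
  have h : cutPlane = (fun z : ℂ => 1 - z) '' Complex.slitPlane := by
    rw [cutPlane_eq]
    ext z
    constructor
    · intro hz
      exact ⟨1 - z, hz, by ring⟩
    · rintro ⟨w, hw, rfl⟩
      simpa using hw
  rw [h]
  exact (Complex.starConvex_one_slitPlane.isPathConnected
    Complex.one_mem_slitPlane).isConnected.isPreconnected.image _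
    (by fun_prop)

/-- The continuation is unique on the cut plane, so that `hyperF` does not depend on choices. -/
theorem IsHyperContinuation.eqOn {q : ℕ} {σ : ℂ} {A B : Fin q → ℂ} {f g : ℂ → ℂ}
    (hf : IsHyperContinuation σ A B f) (hg : IsHyperContinuation σ A B g) :
    Set.EqOn f g cutPlane := by
  refine (hf.differentiableOn.analyticOnNhd isOpen_cutPlane).eqOn_of_preconnected_of_eventuallyEq
    (hg.differentiableOn.analyticOnNhd isOpen_cutPlane) isPreconnected_cutPlane (z₀ := 0)
    (by simp [cutPlane]) ?_
  filter_upwards [Metric.ball_mem_nhds (0 : ℂ) one_pos] with z hz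
  have hz1 : ‖z‖ < 1 := by simpa using hz
  exact (hf.hasSum z hz1).unique (hg.hasSum z hz1)

theorem hyperF_eqOn {q : ℕ} {σ : ℂ} {A B : Fin q → ℂ} {f : ℂ → ℂ}
    (hf : IsHyperContinuation σ A B f) : Set.EqOn (hyperF σ A B) f cutPlane := by
  have h : ∃ f : ℂ → ℂ, IsHyperContinuation σ A B f := ⟨f, hf⟩
  intro z hz
  simp only [hyperF, dif_pos h]
  exact h.choose_spec.eqOn hf hz

/-- `B` is weakly supermajorized by `A`: both tuples are positive and nondecreasing, and each
partial sum of `A` is at most the corresponding partial sum of `B`. -/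
structure WeaklySupermajorizedBy {q : ℕ} (B A : Fin q → ℝ) : Prop where
  pos_A : ∀ i, 0 < A i
  mono_A : Monotone A
  pos_B : ∀ i, 0 < B i
  mono_B : Monotone B
  sum_le : ∀ k : Fin q, ∑ i ∈ Finset.Iic k, A i ≤ ∑ i ∈ Finset.Iic k, B i

/-! Put m(s) = ∏ Γ(aᵢ+s)Γ(bᵢ) / (Γ(bᵢ+s)Γ(aᵢ)). Suppose m(s) = E[T^s] for a random T in [0,1] with
law μ. Then m(n) = ∏ (aᵢ)ₙ/(bᵢ)ₙ, and the binomial series gives F(z) = ∫ (1-zt)^(-σ) dμ(t), which is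
holomorphic off [1,∞). The value m(δ+n) likewise represents the shifted function by the same μ with
the increasing density t^δ/m(δ). So the quotient at -x is the mean of t^δ/m(δ) under the normalized
weight (1+xt)^(-σ) dμ. As x grows this weight moves towards small t if σ > 0 and large t if σ < 0;
Chebyshev's inequality makes this precise.

To construct T, expand m by Euler's limit as an infinite product of rational functions of s.
Products of independent variables reduce the task to one rational factor
(`isMomentFunction_prod_shift`). Majorization splits that factor into transfers between two entries
and single shifts a ≤ b, each a mixture of a point mass at 1 and powers of uniform variables. -/

open MeasureTheory ProbabilityTheory Filter Topology

/-! ### Moment functions and their closure properties -/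

/-- `m` is the moment function `s ↦ E[T ^ s]`, `s ≥ 0`, of a random variable `T` with values in the
unit interval. -/
def IsMomentFunction (m : ℝ → ℝ) : Prop :=
  ∃ μ : Measure unitInterval, IsProbabilityMeasure μ ∧ ∀ s : ℝ, 0 ≤ s → ∫ t, (t : ℝ) ^ s ∂μ = m s

theorem unitInterval.continuous_rpow {s : ℝ} (hs : 0 ≤ s) :
    Continuous fun t : unitInterval => (t : ℝ) ^ s :=
  continuous_subtype_val.rpow_const fun _ => Or.inr hs

theorem unitInterval.rpow_nonneg (t : unitInterval) (s : ℝ) : 0 ≤ (t : ℝ) ^ s :=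
  Real.rpow_nonneg t.2.1 s

theorem unitInterval.rpow_le_one (t : unitInterval) {s : ℝ} (hs : 0 ≤ s) : (t : ℝ) ^ s ≤ 1 :=
  Real.rpow_le_one t.2.1 t.2.2 hs

theorem unitInterval.integrable_of_continuous {E : Type*} [NormedAddCommGroup E] {f : unitInterval → E}
    (hf : Continuous f) (μ : Measure unitInterval) [IsFiniteMeasure μ] : Integrable f μ :=
  hf.integrable_of_hasCompactSupport (HasCompactSupport.of_compactSpace f)

theorem IsMomentFunction.congr {m m' : ℝ → ℝ} (h : IsMomentFunction m)
    (hm : ∀ s, 0 ≤ s → m s = m' s) : IsMomentFunction m' := by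
  obtain ⟨μ, hμ, H⟩ := h
  exact ⟨μ, hμ, fun s hs => (H s hs).trans (hm s hs)⟩

theorem isMomentFunction_one : IsMomentFunction fun _ => 1 :=
  ⟨Measure.dirac 1, inferInstance, fun s _ => by simp⟩

/-- Infinite products of moment functions: the moment function of a product of independent
variables. -/
theorem IsMomentFunction.of_tendsto_prod {m : ℕ → ℝ → ℝ} {M : ℝ → ℝ}
    (hm : ∀ j, IsMomentFunction (m j))
    (hM : ∀ s, 0 ≤ s → Tendsto (fun N => ∏ j ∈ Finset.range N, m j s) atTop (𝓝 (M s))) :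
    IsMomentFunction M := by
  choose μ hμ H using hm
  let P := Measure.infinitePi μ
  let T : ℕ → (ℕ → unitInterval) → unitInterval := fun N ω => ∏ j ∈ Finset.range N, ω j
  have hT : ∀ N, Measurable (T N) := fun N => by
    have : Continuous (T N) := by fun_prop
    exact this.measurable
  -- Factors in [0,1] make the partial products decrease, so they converge at every ω, whatever the
  -- laws.
  have hanti : ∀ ω, Antitone fun N => T N ω := fun ω => antitone_nat_of_succ_le fun N => by
    simp only [T, Finset.prod_range_succ]
    exact unitInterval.mul_le_left
  have hlim : ∀ ω, Tendsto (fun N => T N ω) atTop (𝓝 (⨅ N, T N ω)) := fun ω =>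
    tendsto_atTop_iInf (hanti ω)
  have hTm : Measurable fun ω => ⨅ N, T N ω :=
    measurable_of_tendsto_metrizable hT (tendsto_pi_nhds.2 hlim)
  refine ⟨P.map fun ω => ⨅ N, T N ω, Measure.isProbabilityMeasure_map hTm.aemeasurable,
    fun s hs => ?_⟩
  have hc := unitInterval.continuous_rpow hs
  rw [integral_map hTm.aemeasurable hc.aestronglyMeasurable]
  refine tendsto_nhds_unique (f := fun N => ∫ ω, (T N ω : ℝ) ^ s ∂P) (l := atTop) ?_ ?_
  · refine tendsto_integral_of_dominated_convergence (fun _ => 1)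
      (fun N => (hc.measurable.comp (hT N)).aestronglyMeasurable) (integrable_const _)
      (fun N => ae_of_all _ fun ω => ?_)
      (ae_of_all _ fun ω => (hc.tendsto _).comp (hlim ω))
    rw [Real.norm_of_nonneg (unitInterval.rpow_nonneg _ _)]
    exact unitInterval.rpow_le_one _ hs
  · refine (hM s hs).congr fun N => ?_
    have hind : iIndepFun (fun (j : Fin N) (ω : ℕ → unitInterval) => ω j) P :=
      (iIndepFun_infinitePi (P := μ) (X := fun _ t => t) fun _ => measurable_id).precomp
        Fin.val_injective
    have := hind.integral_fun_prod_comp (f := fun _ t => ((t : unitInterval) : ℝ) ^ s)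
      (fun j => (measurable_pi_apply _).aemeasurable) (fun j => hc.aestronglyMeasurable)
    have hj : ∀ j : ℕ, ∫ ω, ((ω j : unitInterval) : ℝ) ^ s ∂P = m j s := fun j => by
      rw [← H j s hs, ← Measure.infinitePi_map_eval μ j,
        integral_map (measurable_pi_apply j).aemeasurable hc.aestronglyMeasurable]
    simp only [hj] at this
    rw [Finset.prod_range, ← this]
    refine integral_congr_ae (ae_of_all _ fun ω => ?_)
    simp only [T, Finset.prod_range]
    refine (Real.finsetProd_rpow Finset.univ (fun i : Fin N => (ω i : ℝ))
      (fun i _ => (ω i).2.1) s).trans ?_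
    congr 1
    exact map_prod (Submonoid.subtype unitInterval.submonoid) (fun i : Fin N => ω i) Finset.univ |>.symm

theorem IsMomentFunction.mul {m₁ m₂ : ℝ → ℝ} (h₁ : IsMomentFunction m₁)
    (h₂ : IsMomentFunction m₂) : IsMomentFunction fun s => m₁ s * m₂ s := by
  refine IsMomentFunction.of_tendsto_prod
    (m := fun j => if j = 0 then m₁ else if j = 1 then m₂ else fun _ => 1) (fun j => ?_)
    fun s _ => ?_
  · split_ifs
    exacts [h₁, h₂, isMomentFunction_one]
  · refine tendsto_const_nhds.congr' ?_
    filter_upwards [eventually_ge_atTop 2] with N hN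
    rw [← Finset.prod_subset (Finset.range_subset_range.2 hN)]
    · simp [Finset.prod_range_succ]
    · intro j _ hj
      rw [Finset.mem_range, not_lt] at hj
      rw [if_neg (by lia), if_neg (by lia)]

theorem IsMomentFunction.prod {ι : Type*} (S : Finset ι) {m : ι → ℝ → ℝ}
    (h : ∀ i, IsMomentFunction (m i)) : IsMomentFunction fun s => ∏ i ∈ S, m i s := by
  classical
  induction S using Finset.induction_on with
  | empty => simpa using isMomentFunction_one
  | insert i S hi ih =>
    simp only [Finset.prod_insert hi]
    exact (h i).mul ih

/-- Mix the given law with a point mass at 1, which has weight p. -/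
theorem IsMomentFunction.convex_one {m : ℝ → ℝ} (h : IsMomentFunction m) {p : ℝ} (hp : 0 ≤ p)
    (hp1 : p ≤ 1) : IsMomentFunction fun s => p + (1 - p) * m s := by
  obtain ⟨μ, hμ, H⟩ := h
  refine ⟨ENNReal.ofReal p • Measure.dirac 1 + ENNReal.ofReal (1 - p) • μ, ⟨?_⟩, fun s hs => ?_⟩
  · simp [← ENNReal.ofReal_add hp (sub_nonneg.2 hp1)]
  · have hc := unitInterval.continuous_rpow hs
    rw [integral_add_measure, integral_smul_measure, integral_smul_measure, H s hs]
    · simp [ENNReal.toReal_ofReal hp, ENNReal.toReal_ofReal (sub_nonneg.2 hp1)]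
    · exact (unitInterval.integrable_of_continuous hc _).smul_measure ENNReal.ofReal_ne_top
    · exact (unitInterval.integrable_of_continuous hc _).smul_measure ENNReal.ofReal_ne_top

/-! ### Elementary rational moment functions -/

/-- Take T = U^(1/a) with U uniform on [0,1]. -/
theorem isMomentFunction_div_add {a : ℝ} (ha : 0 < a) : IsMomentFunction fun s => a / (a + s) := by
  let g : unitInterval → unitInterval := fun t => ⟨(t : ℝ) ^ a⁻¹, unitInterval.rpow_nonneg _ _,
    unitInterval.rpow_le_one _ (inv_nonneg.2 ha.le)⟩
  have hg : Measurable g :=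
    ((unitInterval.continuous_rpow (inv_nonneg.2 ha.le)).subtype_mk _).measurable
  refine ⟨volume.map g, Measure.isProbabilityMeasure_map hg.aemeasurable, fun s hs => ?_⟩
  rw [integral_map hg.aemeasurable (unitInterval.continuous_rpow hs).aestronglyMeasurable]
  have h1 : ∀ t : unitInterval, ((g t : unitInterval) : ℝ) ^ s = (t : ℝ) ^ (s / a) := fun t => by
    rw [← Real.rpow_mul t.2.1, inv_mul_eq_div]
  have h0 : 0 ≤ s / a := by positivity
  simp only [h1]
  rw [show (volume : Measure unitInterval) = Measure.comap Subtype.val volume from rfl,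
    integral_subtype_comap measurableSet_Icc (fun t : ℝ => t ^ (s / a)),
    integral_Icc_eq_integral_Ioc, ← intervalIntegral.integral_of_le zero_le_one,
    integral_rpow (Or.inl (by linarith)), Real.one_rpow, Real.zero_rpow (by linarith)]
  field_simp
  ring

/-- The function equals p + (1-p)·a/(a+s) with p = a/b. -/
theorem isMomentFunction_shift {a b : ℝ} (ha : 0 < a) (hab : a ≤ b) :
    IsMomentFunction fun s => (b + s) * a / ((a + s) * b) := by
  have hb : 0 < b := ha.trans_le hab
  refine ((isMomentFunction_div_add ha).convex_one (p := a / b) (by positivity)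
    ((div_le_one hb).2 hab)).congr fun s hs => ?_
  have : a + s ≠ 0 := by positivity
  field_simp
  ring

/-- The function equals p + (1-p)·a₁a₂/((a₁+s)(a₂+s)) with p = a₁a₂/((a₁+e)(a₂-e)). Here p ≤ 1
because (a₁+e)(a₂-e) - a₁a₂ = e(a₂-a₁-e) ≥ 0. -/
theorem isMomentFunction_transfer {a₁ a₂ e : ℝ} (h₁ : 0 < a₁) (he : 0 ≤ e) (h : a₁ + e ≤ a₂) :
    IsMomentFunction fun s =>
      a₁ * (a₁ + e + s) / ((a₁ + e) * (a₁ + s)) * (a₂ * (a₂ - e + s) / ((a₂ - e) * (a₂ + s))) := by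
  have h₂ : 0 < a₂ := by linarith
  have h₃ : 0 < a₁ + e := by linarith
  have h₄ : 0 < a₂ - e := by linarith
  have hp : a₁ * a₂ / ((a₁ + e) * (a₂ - e)) ≤ 1 := by
    rw [div_le_one (by positivity)]
    nlinarith
  refine (((isMomentFunction_div_add h₁).mul (isMomentFunction_div_add h₂)).convex_one
    (by positivity) hp).congr fun s hs => ?_
  have : a₁ + s ≠ 0 := by positivity
  have : a₂ + s ≠ 0 := by positivity
  field_simp
  ring

/-! ### Majorization by successive transfers -/

/-- If the partial sums of `a` are dominated by those of `b`, but `a` does not lie below `b`, then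
the first entry of `a` exceeding that of `b` is preceded by an entry smaller than that of `b`. -/
theorem exists_transfer_of_sum_le {q : ℕ} {a b : Fin q → ℝ}
    (hsum : ∀ k, ∑ i ∈ Finset.Iic k, a i ≤ ∑ i ∈ Finset.Iic k, b i) (hab : ¬ ∀ i, a i ≤ b i) :
    ∃ i k, i < k ∧ a i < b i ∧ b k < a k ∧ ∀ j < k, a j ≤ b j := by
  push Not at hab
  obtain ⟨k, hk, hmin⟩ := WellFounded.has_min (wellFounded_lt (α := Fin q)) {k | b k < a k} hab
  have hlt : ∀ j < k, a j ≤ b j := fun j hj => not_lt.1 fun h => hmin j h hj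
  by_contra! H
  refine (hsum k).not_gt (Finset.sum_lt_sum (fun j hj => ?_) ⟨k, by simp, hk⟩)
  rcases (Finset.mem_Iic.1 hj).lt_or_eq with hj | rfl
  · by_contra! hl
    obtain ⟨l, hl, hl'⟩ := H j k hj hl hk
    exact hl'.not_ge (hlt l hl)
  · exact le_of_lt hk

/-- Induction on the number of indices where a and b differ: a transfer from a later to an earlier
entry settles at least one of them. Only b is assumed monotone, since transfers may destroy the
order of a. -/
theorem isMomentFunction_prod_shift {q : ℕ} {b : Fin q → ℝ} (hb : ∀ i, 0 < b i)
    (hmono : Monotone b) {a : Fin q → ℝ} (ha : ∀ i, 0 < a i)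
    (hsum : ∀ k, ∑ i ∈ Finset.Iic k, a i ≤ ∑ i ∈ Finset.Iic k, b i) :
    IsMomentFunction fun s => ∏ i, (b i + s) * a i / ((a i + s) * b i) := by
  induction hn : (Finset.univ.filter fun i => a i ≠ b i).card using Nat.strong_induction_on
    generalizing a with
  | _ n ih =>
  by_cases hab : ∀ i, a i ≤ b i
  · exact IsMomentFunction.prod _ fun i => isMomentFunction_shift (ha i) (hab i)
  obtain ⟨i, k, hik, hi, hk, hlt⟩ := exists_transfer_of_sum_le hsum hab
  -- The largest transfer overshooting neither target; with bᵢ ≤ bₖ it gives aᵢ+e ≤ bᵢ ≤ bₖ ≤ aₖ-e.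
  set e := min (b i - a i) (a k - b k) with he
  have he0 : 0 < e := lt_min (by linarith) (by linarith)
  have hei : a i + e ≤ b i := by linarith [min_le_left (b i - a i) (a k - b k)]
  have hek : b k ≤ a k - e := by linarith [min_le_right (b i - a i) (a k - b k)]
  have hbik := hmono hik.le
  let a' : Fin q → ℝ := fun j => a j + (if i = j then e else 0) - (if k = j then e else 0)
  have ha'i : a' i = a i + e := by simp [a', hik.ne']
  have ha'k : a' k = a k - e := by simp [a', hik.ne]
  have ha'j : ∀ j, j ≠ i ∧ j ≠ k → a' j = a j := fun j hj => by
    simp [a', hj.1.symm, hj.2.symm]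
  have ha' : ∀ j, 0 < a' j := fun j => by
    by_cases hji : j = i
    · rw [hji, ha'i]; linarith [ha i]
    by_cases hjk : j = k
    · rw [hjk, ha'k]; linarith [hb k]
    rw [ha'j j ⟨hji, hjk⟩]; exact ha j
  have hsum' : ∀ j, ∑ l ∈ Finset.Iic j, a' l ≤ ∑ l ∈ Finset.Iic j, b l := fun j => by
    have hS : ∑ l ∈ Finset.Iic j, a' l =
        ∑ l ∈ Finset.Iic j, a l + (if i ≤ j then e else 0) - (if k ≤ j then e else 0) := by
      simp [a', Finset.sum_add_distrib, Finset.sum_sub_distrib]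
    rw [hS]
    by_cases hkj : k ≤ j
    · rw [if_pos hkj, if_pos (hik.le.trans hkj)]
      linarith [hsum j]
    by_cases hij : i ≤ j
    · rw [if_pos hij, if_neg hkj]
      -- All terms b-a before k are nonnegative, so the slack of this partial sum is at least bᵢ-aᵢ
      -- ≥ e.
      have := Finset.single_le_sum (s := Finset.Iic j) (f := fun l => b l - a l)
        (fun l hl => sub_nonneg.2 (hlt l ((Finset.mem_Iic.1 hl).trans_lt (not_le.1 hkj))))
        (Finset.mem_Iic.2 hij)
      rw [Finset.sum_sub_distrib] at this
      linarith
    · rw [if_neg hij, if_neg hkj]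
      linarith [hsum j]
  have hcard : (Finset.univ.filter fun j => a' j ≠ b j).card < n := by
    rw [← hn]
    refine Finset.card_lt_card (Finset.ssubset_iff_subset_ne.2 ⟨fun j hj => ?_, fun h => ?_⟩)
    · simp only [Finset.mem_filter, Finset.mem_univ, true_and] at hj ⊢
      by_cases hji : j = i
      · rw [hji]; exact hi.ne
      by_cases hjk : j = k
      · rw [hjk]; exact hk.ne'
      rwa [ha'j j ⟨hji, hjk⟩] at hj
    · have h1 : a' i ≠ b i := by
        have : i ∈ Finset.univ.filter fun j => a' j ≠ b j := by rw [h]; simp [hi.ne]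
        simpa using this
      have h2 : a' k ≠ b k := by
        have : k ∈ Finset.univ.filter fun j => a' j ≠ b j := by rw [h]; simp [hk.ne']
        simpa using this
      rw [ha'i] at h1
      rw [ha'k] at h2
      rcases min_choice (b i - a i) (a k - b k) with h | h
      · exact h1 (by linarith)
      · exact h2 (by linarith)
  refine ((isMomentFunction_transfer (ha i) he0.le
    (show a i + e ≤ a k by linarith)).mul (ih _ hcard ha' hsum' rfl)).congr fun s hs => ?_
  have hprod : ∏ j, a j * (a' j + s) / (a' j * (a j + s)) =
      a i * (a i + e + s) / ((a i + e) * (a i + s)) *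
        (a k * (a k - e + s) / ((a k - e) * (a k + s))) := by
    rw [Fintype.prod_eq_mul i k hik.ne, ha'i, ha'k]
    intro j hj
    rw [ha'j j hj]
    exact div_self (by have := ha j; positivity)
  rw [← hprod, ← Finset.prod_mul_distrib]
  refine Finset.prod_congr rfl fun j _ => ?_
  have := ha j
  have := ha' j
  have := hb j
  field_simp

/-! ### Gamma quotients as moment functions -/

/-- The Mellin transform `∏ Γ(aᵢ + s) / Γ(bᵢ + s)`, normalized to be `1` at `s = 0`. -/
noncomputable def gammaRatio {q : ℕ} (a b : Fin q → ℝ) (s : ℝ) : ℝ :=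
  ∏ i, Real.Gamma (a i + s) * Real.Gamma (b i) / (Real.Gamma (b i + s) * Real.Gamma (a i))

/-- Euler's limit for the four Gammas: the powers of n and the factorials cancel. -/
theorem Real.tendsto_prod_div_gamma {a b : ℝ} (ha : 0 < a) (hb : 0 < b) {s : ℝ} (hs : 0 ≤ s) :
    Tendsto (fun N => ∏ j ∈ Finset.range N, (b + j + s) * (a + j) / ((a + j + s) * (b + j))) atTop
      (𝓝 (Real.Gamma (a + s) * Real.Gamma b / (Real.Gamma (b + s) * Real.Gamma a))) := by
  -- `Real.GammaSeq` at n has n+1 factors in its denominator.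
  rw [← tendsto_add_atTop_iff_nat 1]
  have hbs := (Real.Gamma_pos_of_pos (show 0 < b + s by linarith)).ne'
  have hag := (Real.Gamma_pos_of_pos ha).ne'
  refine (((Real.GammaSeq_tendsto_Gamma (a + s)).mul (Real.GammaSeq_tendsto_Gamma b)).div
    ((Real.GammaSeq_tendsto_Gamma (b + s)).mul (Real.GammaSeq_tendsto_Gamma a))
    (mul_ne_zero hbs hag)).congr' ?_
  filter_upwards [eventually_gt_atTop 0] with n hn
  have hpos : ∀ c : ℝ, 0 < c → 0 < ∏ j ∈ Finset.range (n + 1), (c + j) := fun c hc =>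
    Finset.prod_pos fun j _ => by positivity
  have h1 := hpos a ha
  have h2 := hpos b hb
  have h3 := hpos (a + s) (by linarith)
  have h4 := hpos (b + s) (by linarith)
  have hn' : (0 : ℝ) < n := by exact_mod_cast hn
  have hfac : (0 : ℝ) < n.factorial := by exact_mod_cast n.factorial_pos
  have e1 := Real.rpow_add hn' a s
  have e2 := Real.rpow_add hn' b s
  have p1 := Real.rpow_pos_of_pos hn' a
  have p2 := Real.rpow_pos_of_pos hn' b
  have p3 := Real.rpow_pos_of_pos hn' s
  simp only [Finset.prod_div_distrib, Finset.prod_mul_distrib, Pi.div_apply,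
    Real.GammaSeq, e1, e2, add_right_comm _ _ s]
  simp only [add_right_comm _ s] at h3 h4 ⊢
  field_simp

/-- Adding j to all entries preserves the hypotheses, so every Euler factor is a moment function. -/
theorem WeaklySupermajorizedBy.isMomentFunction {q : ℕ} {A B : Fin q → ℝ}
    (h : WeaklySupermajorizedBy B A) : IsMomentFunction (gammaRatio A B) := by
  refine IsMomentFunction.of_tendsto_prod (m := fun j s =>
    ∏ i, (B i + j + s) * (A i + j) / ((A i + j + s) * (B i + j))) (fun j => ?_) fun s hs => ?_
  · refine isMomentFunction_prod_shift (b := fun i => B i + j) (a := fun i => A i + j)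
      (fun i => by have := h.pos_B i; positivity) (fun i k hik => by simpa using h.mono_B hik)
      (fun i => by have := h.pos_A i; positivity) fun k => ?_
    simpa [Finset.sum_add_distrib] using h.sum_le k
  · simp only [gammaRatio]
    simp_rw [Finset.prod_comm (s := Finset.range _)]
    exact tendsto_finsetProd _ fun i _ => Real.tendsto_prod_div_gamma (h.pos_A i) (h.pos_B i) hs

theorem Real.gamma_add_nat {a : ℝ} (ha : 0 < a) (n : ℕ) :
    Real.Gamma (a + n) = (ascPochhammer ℝ n).eval a * Real.Gamma a := by
  induction n with
  | zero => simp
  | succ n ih =>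
    rw [Nat.cast_succ, ← add_assoc, Real.Gamma_add_one (by positivity), ih,
      ascPochhammer_succ_eval]
    ring

theorem gammaRatio_add_nat {q : ℕ} {A B : Fin q → ℝ} (hA : ∀ i, 0 < A i) (hB : ∀ i, 0 < B i)
    {s : ℝ} (hs : 0 ≤ s) (n : ℕ) :
    gammaRatio A B (s + n) = gammaRatio A B s *
      ∏ i, (ascPochhammer ℝ n).eval (A i + s) / (ascPochhammer ℝ n).eval (B i + s) := by
  simp only [gammaRatio, ← Finset.prod_mul_distrib]
  refine Finset.prod_congr rfl fun i _ => ?_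
  have hA' : 0 < A i + s := by linarith [hA i]
  have hB' : 0 < B i + s := by linarith [hB i]
  rw [← add_assoc, ← add_assoc, Real.gamma_add_nat hA', Real.gamma_add_nat hB']
  have := ascPochhammer_pos n _ hB'
  have := Real.Gamma_pos_of_pos hB'
  have := Real.Gamma_pos_of_pos (hA i)
  field_simp

theorem gammaRatio_zero {q : ℕ} {A B : Fin q → ℝ} (hA : ∀ i, 0 < A i) (hB : ∀ i, 0 < B i) :
    gammaRatio A B 0 = 1 := by
  refine Finset.prod_eq_one fun i _ => ?_
  have := Real.Gamma_pos_of_pos (hA i)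
  have := Real.Gamma_pos_of_pos (hB i)
  simp only [add_zero]
  field_simp

theorem gammaRatio_pos {q : ℕ} {A B : Fin q → ℝ} (hA : ∀ i, 0 < A i) (hB : ∀ i, 0 < B i)
    {s : ℝ} (hs : 0 ≤ s) : 0 < gammaRatio A B s := by
  refine Finset.prod_pos fun i _ => ?_
  have := Real.Gamma_pos_of_pos (hA i)
  have := Real.Gamma_pos_of_pos (hB i)
  have := Real.Gamma_pos_of_pos (add_pos_of_pos_of_nonneg (hA i) hs)
  have := Real.Gamma_pos_of_pos (add_pos_of_pos_of_nonneg (hB i) hs)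
  positivity

/-! ### Integral representation and analytic continuation -/

theorem hyperCoeff_ofReal {q : ℕ} (σ : ℂ) (A B : Fin q → ℝ) (n : ℕ) :
    hyperCoeff σ (fun i => (A i : ℂ)) (fun i => (B i : ℂ)) n =
      (ascPochhammer ℂ n).eval σ / n.factorial *
        ((∏ i, (ascPochhammer ℝ n).eval (A i) / (ascPochhammer ℝ n).eval (B i) : ℝ) : ℂ) := by
  have h : ∀ x : ℝ, (ascPochhammer ℂ n).eval (x : ℂ) = (((ascPochhammer ℝ n).eval x : ℝ) : ℂ) :=
    fun x => by
      rw [← ascPochhammer_map Complex.ofRealHom, Polynomial.eval_map]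
      exact Polynomial.eval₂_at_apply Complex.ofRealHom x
  simp only [hyperCoeff, h, Finset.prod_div_distrib]
  push_cast
  rw [div_mul_div_comm, mul_comm (n.factorial : ℂ)]

theorem Complex.hasSum_one_sub_cpow_neg (σ : ℂ) {z : ℂ} (hz : ‖z‖ < 1) :
    HasSum (fun n : ℕ => (ascPochhammer ℂ n).eval σ / n.factorial * z ^ n) ((1 - z) ^ (-σ)) := by
  have h := (Complex.one_div_one_sub_cpow_hasFPowerSeriesOnBall_zero σ).hasSum (y := z) (by
    rw [← ENNReal.ofReal_one, Metric.eball_ofReal]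
    simpa using hz)
  have hc : ∀ n : ℕ, Ring.choose (σ + n - 1) n = (ascPochhammer ℂ n).eval σ / n.factorial :=
    fun n => by
      have h1 := Ring.factorial_nsmul_multichoose_eq_ascPochhammer σ n
      rw [Polynomial.ascPochhammer_smeval_eq_eval, nsmul_eq_mul] at h1
      rw [eq_div_iff (by exact_mod_cast n.factorial_ne_zero), ← h1, mul_comm]
      congr 1
      change Ring.multichoose _ _ = _
      congr 1
      ring
  simpa [hc, Complex.cpow_neg, FormalMultilinearSeries.ofScalars, mul_comm] using h

theorem one_sub_mul_mem_slitPlane {z : ℂ} (hz : z ∈ cutPlane) (t : unitInterval) :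
    1 - z * (t : ℝ) ∈ Complex.slitPlane := by
  rw [cutPlane_eq] at hz
  have h := Complex.starConvex_one_slitPlane hz (sub_nonneg.2 t.2.2) t.2.1 (by ring)
  simp only [Complex.real_smul] at h
  convert h using 1
  push_cast
  ring

theorem continuousOn_one_sub_mul_cpow (c : ℂ) :
    ContinuousOn (fun p : ℂ × unitInterval => (1 - p.1 * ((p.2 : ℝ) : ℂ)) ^ c) (cutPlane ×ˢ Set.univ) := by
  refine ContinuousOn.cpow_const (by fun_prop) fun p hp => one_sub_mul_mem_slitPlane hp.1 p.2

theorem continuous_one_sub_mul_cpow {z : ℂ} (hz : z ∈ cutPlane) (c : ℂ) :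
    Continuous fun t : unitInterval => (1 - z * ((t : ℝ) : ℂ)) ^ c :=
  (continuousOn_one_sub_mul_cpow c).comp_continuous (f := fun t : unitInterval => (z, t)) (by fun_prop)
    fun _ => ⟨hz, trivial⟩

theorem differentiableOn_integral_one_sub_mul_cpow (μ : Measure unitInterval) [IsFiniteMeasure μ] {w : unitInterval → ℝ}
    (hw : Continuous w) (c : ℂ) :
    DifferentiableOn ℂ (fun z => ∫ t, (1 - z * ((t : ℝ) : ℂ)) ^ c * w t ∂μ) cutPlane := by
  intro z₀ hz₀
  obtain ⟨ε, hε, hball⟩ := Metric.nhds_basis_closedBall.mem_iff.1 (isOpen_cutPlane.mem_nhds hz₀)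
  have hwC : Continuous fun t : unitInterval => (w t : ℂ) := by fun_prop
  let F' : ℂ → unitInterval → ℂ := fun z t => c * (1 - z * ((t : ℝ) : ℂ)) ^ (c - 1) * (-((t : ℝ) : ℂ)) * w t
  have hF' : ContinuousOn (fun p : ℂ × unitInterval => F' p.1 p.2) (cutPlane ×ˢ Set.univ) :=
    ((continuousOn_const.mul (continuousOn_one_sub_mul_cpow (c - 1))).mul (by fun_prop)).mul
      (by fun_prop)
  -- Compactness of the closed ball times [0,1] gives a uniform bound for differentiating under the
  -- integral.
  obtain ⟨C, hC⟩ := ((isCompact_closedBall z₀ ε).prod (isCompact_univ (X := unitInterval))).exists_bound_of_continuousOn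
    (hF'.mono (Set.prod_mono_left hball))
  have hint : ∀ z ∈ cutPlane, Continuous fun t : unitInterval => (1 - z * ((t : ℝ) : ℂ)) ^ c * w t :=
    fun z hz => (continuous_one_sub_mul_cpow hz c).mul hwC
  have hcF' : Continuous (F' z₀) :=
    ((continuous_const.mul (continuous_one_sub_mul_cpow hz₀ (c - 1))).mul (by fun_prop)).mul hwC
  refine (hasDerivAt_integral_of_dominated_loc_of_deriv_le (F' := F') (bound := fun _ => C)
    (Metric.closedBall_mem_nhds z₀ hε) ?_ (unitInterval.integrable_of_continuous (hint z₀ hz₀) μ)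
    hcF'.aestronglyMeasurable ?_ (integrable_const C) ?_).2.differentiableAt.differentiableWithinAt
  · filter_upwards [isOpen_cutPlane.mem_nhds hz₀] with z hz
    exact (hint z hz).aestronglyMeasurable
  · exact ae_of_all _ fun t z hz => hC (z, t) ⟨hz, trivial⟩
  · refine ae_of_all _ fun t z hz => ?_
    have h1 : HasDerivAt (fun z : ℂ => 1 - z * ((t : ℝ) : ℂ)) (-((t : ℝ) : ℂ)) z := by
      simpa using ((hasDerivAt_id z).mul_const ((t : ℝ) : ℂ)).const_sub 1
    exact (h1.cpow_const (one_sub_mul_mem_slitPlane (hball hz) t)).mul_const _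

theorem hasSum_integral_one_sub_mul_cpow (μ : Measure unitInterval) [IsFiniteMeasure μ] {w : unitInterval → ℝ}
    (hw : Continuous w) (σ : ℂ) {z : ℂ} (hz : ‖z‖ < 1) :
    HasSum (fun n : ℕ => (ascPochhammer ℂ n).eval σ / n.factorial *
        ((∫ t, (t : ℝ) ^ n * w t ∂μ : ℝ) : ℂ) * z ^ n)
      (∫ t, (1 - z * ((t : ℝ) : ℂ)) ^ (-σ) * w t ∂μ) := by
  set c : ℕ → ℂ := fun n => (ascPochhammer ℂ n).eval σ / n.factorial with hc
  have hwC : Continuous fun t : unitInterval => (w t : ℂ) := by fun_prop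
  let F : ℕ → unitInterval → ℂ := fun n t => c n * (z * ((t : ℝ) : ℂ)) ^ n * w t
  have hF : ∀ n, Integrable (F n) μ := fun n =>
    unitInterval.integrable_of_continuous (by fun_prop) μ
  have hnorm : ∀ t : unitInterval, ‖z * ((t : ℝ) : ℂ)‖ ≤ ‖z‖ := fun t => by
    rw [norm_mul, Complex.norm_real, Real.norm_of_nonneg t.2.1]
    exact mul_le_of_le_one_right (norm_nonneg _) t.2.2
  have hsum : Summable fun n => ∫ t, ‖F n t‖ ∂μ := by
    refine Summable.of_nonneg_of_le (fun n => integral_nonneg fun t => norm_nonneg _) (fun n => ?_)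
      ((Complex.hasSum_one_sub_cpow_neg σ hz).summable.norm.mul_right (∫ t, ‖(w t : ℂ)‖ ∂μ))
    rw [← integral_const_mul]
    refine integral_mono (hF n).norm
      ((unitInterval.integrable_of_continuous hwC μ).norm.const_mul _) fun t => ?_
    simp only [F, hc, norm_mul, norm_pow]
    have := hnorm t
    rw [norm_mul] at this
    gcongr
  have hterm : ∀ n, ∫ t, F n t ∂μ = c n * ((∫ t, (t : ℝ) ^ n * w t ∂μ : ℝ) : ℂ) * z ^ n :=
    fun n => by
      have : ∀ t : unitInterval, F n t = c n * z ^ n * (((t : ℝ) ^ n * w t : ℝ) : ℂ) := fun t => by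
        simp only [F]
        push_cast
        ring
      simp only [this]
      rw [integral_const_mul, integral_complex_ofReal]
      ring
  have htsum : ∀ t : unitInterval, ∑' n, F n t = (1 - z * ((t : ℝ) : ℂ)) ^ (-σ) * w t := fun t =>
    ((Complex.hasSum_one_sub_cpow_neg σ ((hnorm t).trans_lt hz)).mul_right (w t : ℂ)).tsum_eq
  simpa only [hterm, htsum] using hasSum_integral_of_summable_integral_norm hF hsum

/-- The generalized Stieltjes transform representation of the hypergeometric function. -/
theorem isHyperContinuation_integral {q : ℕ} (σ : ℂ) {A B : Fin q → ℝ} (μ : Measure unitInterval)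
    [IsFiniteMeasure μ] {w : unitInterval → ℝ} (hw : Continuous w)
    (h : ∀ n : ℕ, ∫ t, (t : ℝ) ^ n * w t ∂μ =
      ∏ i, (ascPochhammer ℝ n).eval (A i) / (ascPochhammer ℝ n).eval (B i)) :
    IsHyperContinuation σ (fun i => (A i : ℂ)) (fun i => (B i : ℂ))
      fun z => ∫ t, (1 - z * ((t : ℝ) : ℂ)) ^ (-σ) * w t ∂μ where
  differentiableOn := differentiableOn_integral_one_sub_mul_cpow μ hw _
  hasSum z hz := by
    simpa only [hyperCoeff_ofReal, h] using hasSum_integral_one_sub_mul_cpow μ hw σ hz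

theorem IsHyperContinuation.hyperF {q : ℕ} {σ : ℂ} {A B : Fin q → ℂ} {f : ℂ → ℂ}
    (hf : IsHyperContinuation σ A B f) : IsHyperContinuation σ A B (hyperF σ A B) := by
  have h : ∃ f : ℂ → ℂ, IsHyperContinuation σ A B f := ⟨f, hf⟩
  have : _root_.hyperF σ A B = h.choose := by
    funext z
    simp only [_root_.hyperF, dif_pos h]
  rw [this]
  exact h.choose_spec

/-! ### The real axis and Chebyshev's inequality -/

theorem neg_ofReal_mem_cutPlane {x : ℝ} (hx : -1 < x) : -(x : ℂ) ∈ cutPlane := by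
  simp only [cutPlane, Set.mem_ofPred_eq, Complex.neg_re, Complex.ofReal_re]
  intro h
  linarith [h.1]

theorem one_add_mul_pos {x : ℝ} (hx : -1 < x) (t : unitInterval) : 0 < 1 + x * (t : ℝ) := by
  rcases t.2.1.eq_or_lt with h | h
  · simp [← h]
  · nlinarith [t.2.2, mul_pos (by linarith : 0 < 1 + x) h]

theorem continuous_one_add_mul_rpow {x : ℝ} (hx : -1 < x) (c : ℝ) :
    Continuous fun t : unitInterval => (1 + x * (t : ℝ)) ^ c :=
  Continuous.rpow_const (by fun_prop) fun t => Or.inl (one_add_mul_pos hx t).ne'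

theorem integral_one_sub_mul_cpow_neg_ofReal (μ : Measure unitInterval) (w : unitInterval → ℝ) (c : ℝ) {x : ℝ}
    (hx : -1 < x) :
    ∫ t, (1 - -(x : ℂ) * ((t : ℝ) : ℂ)) ^ (-(c : ℂ)) * w t ∂μ =
      ((∫ t, (1 + x * (t : ℝ)) ^ (-c) * w t ∂μ : ℝ) : ℂ) := by
  rw [← integral_complex_ofReal]
  refine integral_congr_ae (ae_of_all _ fun t => ?_)
  simp only
  rw [Complex.ofReal_mul, Complex.ofReal_cpow (one_add_mul_pos hx t).le]
  push_cast
  ring_nf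

/-- **Chebyshev's integral inequality** with respect to two densities. -/
theorem integral_mul_integral_le_of_nonneg (μ : Measure unitInterval) [IsProbabilityMeasure μ]
    {u f g : unitInterval → ℝ} (hu : Continuous u) (hf : Continuous f) (hg : Continuous g)
    (h : ∀ s t, 0 ≤ (u t - u s) * (f t * g s - g t * f s)) :
    (∫ t, g t * u t ∂μ) * ∫ t, f t ∂μ ≤ (∫ t, f t * u t ∂μ) * ∫ t, g t ∂μ := by
  have hint : ∀ {k : unitInterval × unitInterval → ℝ}, Continuous k → Integrable k (μ.prod μ) := fun hk =>
    hk.integrable_of_hasCompactSupport (HasCompactSupport.of_compactSpace _)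
  -- By symmetry this double integral is twice the difference of the two sides.
  have h0 : 0 ≤ ∫ p : unitInterval × unitInterval, (u p.1 - u p.2) * (f p.1 * g p.2 - g p.1 * f p.2) ∂(μ.prod μ) :=
    integral_nonneg fun p => h p.2 p.1
  have he : ∀ p : unitInterval × unitInterval, (u p.1 - u p.2) * (f p.1 * g p.2 - g p.1 * f p.2) =
      ((f p.1 * u p.1) * g p.2 - (g p.1 * u p.1) * f p.2) +
        (g p.1 * (f p.2 * u p.2) - f p.1 * (g p.2 * u p.2)) := fun p => by ring
  simp only [he] at h0
  rw [integral_add (hint (by fun_prop)) (hint (by fun_prop)),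
    integral_sub (hint (by fun_prop)) (hint (by fun_prop)),
    integral_sub (hint (by fun_prop)) (hint (by fun_prop)),
    integral_prod_mul (fun t => f t * u t) g, integral_prod_mul (fun t => g t * u t) f,
    integral_prod_mul g (fun t => f t * u t), integral_prod_mul f (fun t => g t * u t)] at h0
  linarith

/-- The difference of the sides is (y-x)(t-s); thus (1+yt)/(1+xt) increases in t. -/
theorem one_add_mul_mul_le {x y : ℝ} (hxy : x ≤ y) {s t : unitInterval} (hst : s ≤ t) :
    (1 + y * (s : ℝ)) * (1 + x * (t : ℝ)) ≤ (1 + x * (s : ℝ)) * (1 + y * (t : ℝ)) := by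
  have : (s : ℝ) ≤ t := hst
  nlinarith [mul_nonneg (sub_nonneg.2 hxy) (sub_nonneg.2 this)]

theorem integral_rpow_mul_le_of_nonpos (μ : Measure unitInterval) [IsProbabilityMeasure μ]
    {u : unitInterval → ℝ} (hu : Continuous u) (hmono : Monotone u) {x y : ℝ} (hx : -1 < x)
    (hxy : x ≤ y) {c : ℝ} (hc : c ≤ 0) :
    (∫ t, (1 + y * (t : ℝ)) ^ c * u t ∂μ) * ∫ t, (1 + x * (t : ℝ)) ^ c ∂μ ≤
      (∫ t, (1 + x * (t : ℝ)) ^ c * u t ∂μ) * ∫ t, (1 + y * (t : ℝ)) ^ c ∂μ := by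
  have p := one_add_mul_pos hx
  have p' := one_add_mul_pos (hx.trans_le hxy)
  have key : ∀ {s t : unitInterval}, s ≤ t → (1 + x * (s : ℝ)) ^ c * (1 + y * (t : ℝ)) ^ c ≤
      (1 + y * (s : ℝ)) ^ c * (1 + x * (t : ℝ)) ^ c := fun {s t} hst => by
    rw [← Real.mul_rpow (p' s).le (p t).le, ← Real.mul_rpow (p s).le (p' t).le]
    exact Real.rpow_le_rpow_of_nonpos (mul_pos (p' s) (p t)) (one_add_mul_mul_le hxy hst) hc
  refine integral_mul_integral_le_of_nonneg μ hu (continuous_one_add_mul_rpow hx c)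
    (continuous_one_add_mul_rpow (hx.trans_le hxy) c) fun s t => ?_
  rcases le_total s t with hst | hst
  · exact mul_nonneg (sub_nonneg.2 (hmono hst)) (by linarith [key hst])
  · exact mul_nonneg_of_nonpos_of_nonpos (sub_nonpos.2 (hmono hst)) (by linarith [key hst])

theorem integral_rpow_mul_le_of_nonneg (μ : Measure unitInterval) [IsProbabilityMeasure μ]
    {u : unitInterval → ℝ} (hu : Continuous u) (hmono : Monotone u) {x y : ℝ} (hx : -1 < x)
    (hxy : x ≤ y) {c : ℝ} (hc : 0 ≤ c) :
    (∫ t, (1 + x * (t : ℝ)) ^ c * u t ∂μ) * ∫ t, (1 + y * (t : ℝ)) ^ c ∂μ ≤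
      (∫ t, (1 + y * (t : ℝ)) ^ c * u t ∂μ) * ∫ t, (1 + x * (t : ℝ)) ^ c ∂μ := by
  have p := one_add_mul_pos hx
  have p' := one_add_mul_pos (hx.trans_le hxy)
  have key : ∀ {s t : unitInterval}, s ≤ t → (1 + y * (s : ℝ)) ^ c * (1 + x * (t : ℝ)) ^ c ≤
      (1 + x * (s : ℝ)) ^ c * (1 + y * (t : ℝ)) ^ c := fun {s t} hst => by
    rw [← Real.mul_rpow (p' s).le (p t).le, ← Real.mul_rpow (p s).le (p' t).le]
    exact Real.rpow_le_rpow (mul_pos (p' s) (p t)).le (one_add_mul_mul_le hxy hst) hc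
  refine integral_mul_integral_le_of_nonneg μ hu (continuous_one_add_mul_rpow (hx.trans_le hxy) c)
    (continuous_one_add_mul_rpow hx c) fun s t => ?_
  rcases le_total s t with hst | hst
  · exact mul_nonneg (sub_nonneg.2 (hmono hst)) (by linarith [key hst])
  · exact mul_nonneg_of_nonpos_of_nonpos (sub_nonpos.2 (hmono hst)) (by linarith [key hst])

theorem integral_one_add_mul_rpow_pos (μ : Measure unitInterval) [IsProbabilityMeasure μ] {x : ℝ}
    (hx : -1 < x) (c : ℝ) : 0 < ∫ t, (1 + x * (t : ℝ)) ^ c ∂μ := by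
  have hpos : ∀ t : unitInterval, 0 < (1 + x * (t : ℝ)) ^ c := fun t =>
    Real.rpow_pos_of_pos (one_add_mul_pos hx t) c
  rw [integral_pos_iff_support_of_nonneg (fun t => (hpos t).le)
    (unitInterval.integrable_of_continuous (continuous_one_add_mul_rpow hx c) μ)]
  have : (Function.support fun t : unitInterval => (1 + x * (t : ℝ)) ^ c) = Set.univ :=
    Set.eq_univ_of_forall fun t => (hpos t).ne'
  rw [this]
  simp

theorem mainTheorem5 (q : ℕ) (A B : Fin q → ℝ) (hBA : WeaklySupermajorizedBy B A)
    (δ : ℝ) (hδ : 0 < δ) (σ : ℝ) (F Fδ : ℂ → ℂ)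
    (hF : F = hyperF (σ : ℂ) (fun i => (A i : ℂ)) (fun i => (B i : ℂ)))
    (hFδ : Fδ = hyperF (σ : ℂ) (fun i => ((A i + δ : ℝ) : ℂ)) (fun i => ((B i + δ : ℝ) : ℂ))) :
    -- the analytic continuations exist, so that `F` and `Fδ` are the intended functions
    IsHyperContinuation (σ : ℂ) (fun i => (A i : ℂ)) (fun i => (B i : ℂ)) F ∧
    IsHyperContinuation (σ : ℂ) (fun i => ((A i + δ : ℝ) : ℂ)) (fun i => ((B i + δ : ℝ) : ℂ)) Fδ ∧
    -- on `(-1, ∞)` the quotient is well defined and real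
    (∀ x : ℝ, -1 < x →
      (F (-(x : ℂ))).im = 0 ∧ (Fδ (-(x : ℂ))).im = 0 ∧ F (-(x : ℂ)) ≠ 0) ∧
    (0 < σ → AntitoneOn (fun x : ℝ => (Fδ (-(x : ℂ)) / F (-(x : ℂ))).re) (Set.Ioi (-1))) ∧
    (σ < 0 → MonotoneOn (fun x : ℝ => (Fδ (-(x : ℂ)) / F (-(x : ℂ))).re) (Set.Ioi (-1))) := by
  have hA := hBA.pos_A
  have hB := hBA.pos_B
  obtain ⟨μ, hμ, H⟩ := hBA.isMomentFunction
  -- Dividing by m(δ) gives u total mass 1 under μ, matching the constant coefficient 1 of the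
  -- shifted series.
  let u : unitInterval → ℝ := fun t => (t : ℝ) ^ δ / gammaRatio A B δ
  have hm := gammaRatio_pos hA hB hδ.le
  have hu : Continuous u := (unitInterval.continuous_rpow hδ.le).div_const _
  have humono : Monotone u := fun s t hst =>
    div_le_div_of_nonneg_right (Real.rpow_le_rpow s.2.1 hst hδ.le) hm.le
  have hC := isHyperContinuation_integral (σ : ℂ) (A := A) (B := B) μ
    (continuous_const (y := (1 : ℝ))) fun n => by
      have h1 := H n n.cast_nonneg
      have h2 := gammaRatio_add_nat hA hB le_rfl n
      simp only [gammaRatio_zero hA hB, zero_add, one_mul, add_zero] at h2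
      simpa [h2] using h1
  have hCδ := isHyperContinuation_integral (σ : ℂ) (A := fun i => A i + δ) (B := fun i => B i + δ) μ
    hu fun n => by
      have h1 := H (δ + n) (by positivity)
      rw [gammaRatio_add_nat hA hB hδ.le n] at h1
      rw [← mul_right_inj' hm.ne', ← h1, ← integral_const_mul]
      refine integral_congr_ae (ae_of_all _ fun t => ?_)
      simp only [u]
      rw [Real.rpow_add_of_nonneg t.2.1 hδ.le n.cast_nonneg, Real.rpow_natCast]
      field_simp
  have hFx : ∀ x : ℝ, -1 < x → F (-(x : ℂ)) = ((∫ t, (1 + x * (t : ℝ)) ^ (-σ) ∂μ : ℝ) : ℂ) :=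
    fun x hx => by
      rw [hF, hyperF_eqOn hC (neg_ofReal_mem_cutPlane hx)]
      simpa using integral_one_sub_mul_cpow_neg_ofReal μ (fun _ => 1) σ hx
  have hFδx : ∀ x : ℝ, -1 < x →
      Fδ (-(x : ℂ)) = ((∫ t, (1 + x * (t : ℝ)) ^ (-σ) * u t ∂μ : ℝ) : ℂ) := fun x hx => by
    rw [hFδ, hyperF_eqOn hCδ (neg_ofReal_mem_cutPlane hx)]
    exact integral_one_sub_mul_cpow_neg_ofReal μ u σ hx
  have hpos := fun (x : ℝ) (hx : -1 < x) => integral_one_add_mul_rpow_pos μ hx (-σ)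
  refine ⟨hF ▸ hC.hyperF, hFδ ▸ hCδ.hyperF, fun x hx => ⟨?_, ?_, ?_⟩, fun hσ x hx y hy hxy => ?_,
    fun hσ x hx y hy hxy => ?_⟩
  · rw [hFx x hx, Complex.ofReal_im]
  · rw [hFδx x hx, Complex.ofReal_im]
  · rw [hFx x hx]
    exact Complex.ofReal_ne_zero.2 (hpos x hx).ne'
  · simp only [hFx x hx, hFx y hy, hFδx x hx, hFδx y hy, ← Complex.ofReal_div, Complex.ofReal_re]
    rw [div_le_div_iff₀ (hpos y hy) (hpos x hx)]
    exact integral_rpow_mul_le_of_nonpos μ hu humono hx hxy (by linarith)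
  · simp only [hFx x hx, hFx y hy, hFδx x hx, hFδx y hy, ← Complex.ofReal_div, Complex.ofReal_re]
    rw [div_le_div_iff₀ (hpos x hx) (hpos y hy)]
    exact integral_rpow_mul_le_of_nonneg μ hu humono hx hxy (by linarith)
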